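/- **Setting.** Let $\mathbf z=(\mathbf z_1,\dots,\mathbf z_N)$ be a random vector with values in an open, simply connected product $\mathcal Z=\mathcal Z_1\times\dots\times\mathcal Z_N\subseteq\mathbb R^N$, with a probability density $p_{\mathbf z}$ that is smooth on $\mathcal Z$ and positive almost everywhere on $\mathcal Z$. For $A\subseteq[N]$ write $\mathbf z_A=(\mathbf z_j)_{j\in A}$ and $\mathcal Z_A=\prod_{j\in A}\mathcal Z_j$. There are $K$ views $\mathbf x_k=f_k(\mathbf z_{S_k})$, $k\in[K]$, where $S_k\subseteq[N]$ and $f_k:\mathcal Z_{S_k}\to\mathcal X_k\subseteq\mathbb R^{D_k}$ is a diffeomorphism. Such data are called a *latent model*. A smooth map $g:\mathcal X_k\to\mathbb R^{|A|}$ *block-identifies* $\mathbf z_A$ (from the view $\mathbf x_k$) if there is a diffeomorphism $h$ from $\mathcal Z_A$ onto a subset of $\mathbb R^{|A|}$ such that $g(\mathbf x_k)=h(\mathbf z_A)$ for all $\mathbf z\in\mathcal Z$. **Corollary (Identifiability Algebra: Intersection).** Let $C_1,C_2\subseteq[N]$ and suppose that, in a given latent model, $\mathbf z_{C_1}$ and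 $\mathbf z_{C_2}$ are block-identified by smooth encoders $g_1$ and $g_2$ of the views $\mathbf x_{k_1}$ and $\mathbf x_{k_2}$ ($k_1=k_2$ is allowed). Then $\mathbf z_{C_1\cap C_2}$ can be block-identified from the two learned representations $g_1(\mathbf x_{k_1})$ and $g_2(\mathbf x_{k_2})$: there are smooth maps $\gamma_i:g_i(\mathcal X_{k_i})\to\mathbb R^{|C_1\cap C_2|}$, $i=1,2$, such that $\gamma_1\circ g_1$ and $\gamma_2\circ g_2$ both block-identify $\mathbf z_{C_1\cap C_2}$. Moreover, $\gamma_1,\gamma_2$ can be chosen in terms of the learned representations alone: they work for every latent model that explains the same representations. That is, for every latent model (with any number of latents and views, any latent space, density, index sets and mixing functions), any index sets $C_1',C_2'$ of its latents and any smooth encoders $g_1',g_2'$ of two of its views $\mathbf x'_{k_1'},\mathbf x'_{k_2'}$ that block-identify $\mathbf z'_{C_1'}$ and $\mathbf z'_{C_2'}$, with the same ranges $g_i'(\mathcal X'_{k_i'})=g_i(\mathcal X_{k_i})$, $i=1,2$, and the same joint distribution of $(g_1'(\mathbf x'_{k_1'}),g_2'(\mathbf x'_{k_2'}))$ as of $(g_1(\mathbf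 x_{k_1}),g_2(\mathbf x_{k_2}))$, the maps $\gamma_1\circ g_1'$ and $\gamma_2\circ g_2'$ both block-identify $\mathbf z'_{C_1'\cap C_2'}$. -/

import Mathlib

open MeasureTheory Set
open scoped ContDiff

/-- `f` restricts to a smooth diffeomorphism from `s` onto `t`: a smooth bijection whose inverse is
smooth on `t`. The set `t` need not be open: it may be a lower-dimensional submanifold of `F`. -/
def IsDiffeoOn {E F : Type*} [NormedAddCommGroup E] [NormedSpace ℝ E]
    [NormedAddCommGroup F] [NormedSpace ℝ F] (f : E → F) (s : Set E) (t : Set F) : Prop :=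
  BijOn f s t ∧ ContDiffOn ℝ ∞ f s ∧
    ∃ f' : F → E, LeftInvOn f' f s ∧ ContDiffOn ℝ ∞ f' t

/-- A multi-view latent variable model with `N` real latent variables and `K` views, the `k`-th view
taking values in `ℝ ^ (D k)`. -/
structure LatentModel (N K : ℕ) (D : Fin K → ℕ) where
  /-- the range of each single latent variable -/
  factor : Fin N → Set ℝ
  /-- the density of the latent vector -/
  density : (Fin N → ℝ) → ℝ
  /-- the indices of the view-specific latents -/
  S : Fin K → Finset (Fin N)
  /-- the observation spaces -/
  X : (k : Fin K) → Set (Fin (D k) → ℝ)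
  /-- the view-specific mixing functions -/
  f : (k : Fin K) → (S k → ℝ) → (Fin (D k) → ℝ)
  isOpen_latent : IsOpen (univ.pi factor)
  simplyConnected_latent : SimplyConnectedSpace (univ.pi factor)
  density_smooth : ContDiffOn ℝ ∞ density (univ.pi factor)
  density_pos : ∀ᵐ z ∂(volume.restrict (univ.pi factor)), 0 < density z
  density_total : ∫⁻ z in univ.pi factor, ENNReal.ofReal (density z) = 1
  mixing_diffeo : ∀ k, IsDiffeoOn (f k) (univ.pi fun j : S k => factor j) (X k)

namespace LatentModel

variable {N K : ℕ} {D : Fin K → ℕ}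

/-- The latent space, the product of the ranges of the latent variables. -/
def latentSpace (M : LatentModel N K D) : Set (Fin N → ℝ) := univ.pi M.factor

/-- The latent subspace in which the block `z_A` takes its values. -/
def blockSpace (M : LatentModel N K D) (A : Finset (Fin N)) : Set (A → ℝ) :=
  univ.pi fun j : A => M.factor j

/-- The distribution of the latent vector. -/
noncomputable def latentLaw (M : LatentModel N K D) : Measure (Fin N → ℝ) :=
  (volume.restrict M.latentSpace).withDensity fun z => ENNReal.ofReal (M.density z)

/-- The `k`-th view `x_k = f_k (z_{S_k})` as a function of the latent vector. -/
def view (M : LatentModel N K D) (k : Fin K) (z : Fin N → ℝ) : Fin (D k) → ℝ :=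
  M.f k ((M.S k).restrict z)

/-- The smooth encoder `g` of the `k`-th view block-identifies the latent block `z_A`: its values
have the dimension of `z_A`, and `g (x_k) = h (z_A)` for a smooth invertible mapping `h`. -/
def BlockIdentifies (M : LatentModel N K D) (k : Fin K) (A : Finset (Fin N)) {m : ℕ}
    (g : (Fin (D k) → ℝ) → (Fin m → ℝ)) : Prop :=
  m = A.card ∧ ContDiffOn ℝ ∞ g (M.X k) ∧
    ∃ h : (A → ℝ) → (Fin m → ℝ), IsDiffeoOn h (M.blockSpace A) (h '' M.blockSpace A) ∧
      ∀ z ∈ M.latentSpace, g (M.view k z) = h (A.restrict z)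

/-- The joint distribution of the representations `g₁ (x_{k₁})` and `g₂ (x_{k₂})`. -/
noncomputable def reprLaw (M : LatentModel N K D) (k₁ k₂ : Fin K) {m₁ m₂ : ℕ}
    (g₁ : (Fin (D k₁) → ℝ) → (Fin m₁ → ℝ)) (g₂ : (Fin (D k₂) → ℝ) → (Fin m₂ → ℝ)) :
    Measure ((Fin m₁ → ℝ) × (Fin m₂ → ℝ)) :=
  M.latentLaw.map fun z => (g₁ (M.view k₁ z), g₂ (M.view k₂ z))

end LatentModel

/-! Take `γᵢ` to be the smooth decoder of `z_{Cᵢ}` in `M`, followed by projection to the coordinates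
in `C₁ ∩ C₂`. In `M` both maps return `z_{C₁ ∩ C₂}`. In another model `M'` with the same law, the
two outputs agree almost surely, hence everywhere, by continuity and almost everywhere positivity of
the density (`eq_of_reprLaw_eq`). A function of `z'_{C₁'}` that is also a function of `z'_{C₂'}`
depends on `z'_{C₁' ∩ C₂'}` only, because the latent space is a product (`eq_of_eqOn_inter`). This
yields a smooth map `ψ` between the shared blocks. Exchanging the models gives a smooth left inverse
of `ψ` (`exists_isDiffeoOn_inter`), and comparing dimensions both ways gives equal cardinalities
(`card_inter_le`). -/

/-- A smooth map with a smooth left inverse on a nonempty open set does not lower the dimension. -/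
theorem IsDiffeoOn.finrank_le {E F : Type*} [NormedAddCommGroup E] [NormedSpace ℝ E]
    [NormedAddCommGroup F] [NormedSpace ℝ F] [FiniteDimensional ℝ F] {f : E → F} {s : Set E}
    {t : Set F} (hf : IsDiffeoOn f s t) (hs : IsOpen s) (hne : s.Nonempty) :
    Module.finrank ℝ E ≤ Module.finrank ℝ F := by
  obtain ⟨hbij, hsmooth, f', hinv, hsmooth'⟩ := hf
  obtain ⟨x, hx⟩ := hne
  have hd : HasFDerivWithinAt f (fderivWithin ℝ f s x) s x :=
    (hsmooth.differentiableOn (by simp) x hx).hasFDerivWithinAt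
  have hd' : HasFDerivWithinAt f' (fderivWithin ℝ f' t (f x)) t (f x) :=
    (hsmooth'.differentiableOn (by simp) _ (hbij.mapsTo hx)).hasFDerivWithinAt
  have hid : HasFDerivWithinAt (f' ∘ f) (ContinuousLinearMap.id ℝ E) s x :=
    (hasFDerivWithinAt_id x s).congr hinv (hinv hx)
  -- Derivatives within the open set `s` are unique, so the chain rule makes the derivative of `f`
  -- left invertible; `t` needs no such uniqueness.
  have hcomp := (hs.uniqueDiffWithinAt hx).eq (hd'.comp x hd hbij.mapsTo) hid
  refine LinearMap.finrank_le_finrank_of_injective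
    (f := (fderivWithin ℝ f s x : E →ₗ[ℝ] F)) fun u v huv => ?_
  have hu := DFunLike.congr_fun hcomp u
  have hv := DFunLike.congr_fun hcomp v
  simp only [ContinuousLinearMap.comp_apply, ContinuousLinearMap.id_apply] at hu hv
  rw [← hu, ← hv]
  exact congrArg _ huv

/-- The vector which agrees with `w` on the block `A` and with `z` outside of it. -/
def extendBlock {ι : Type*} [DecidableEq ι] (A : Finset ι) (z : ι → ℝ) (w : A → ℝ) : ι → ℝ :=
  fun j => if h : j ∈ A then w ⟨j, h⟩ else z j

theorem restrict_extendBlock {ι : Type*} [DecidableEq ι] (A : Finset ι) (z : ι → ℝ) (w : A → ℝ) :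
    A.restrict (extendBlock A z w) = w := by
  ext j
  simp [extendBlock]

theorem contDiff_extendBlock {ι : Type*} [Fintype ι] [DecidableEq ι] (A : Finset ι) (z : ι → ℝ) :
    ContDiff ℝ ∞ (extendBlock A z) := by
  refine contDiff_pi.2 fun j => ?_
  by_cases h : j ∈ A
  · simpa [extendBlock, h] using contDiff_apply ℝ ℝ (⟨j, h⟩ : A)
  · simpa [extendBlock, h] using contDiff_const

theorem contDiff_restrict {ι : Type*} [Fintype ι] (A : Finset ι) :
    ContDiff ℝ ∞ (A.restrict : (ι → ℝ) → (A → ℝ)) :=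
  contDiff_pi.2 fun j => contDiff_apply ℝ ℝ (j : ι)

theorem contDiff_restrict₂ {ι : Type*} {A B : Finset ι} (h : A ⊆ B) :
    ContDiff ℝ ∞ (Finset.restrict₂ (π := fun _ => ℝ) h : (B → ℝ) → (A → ℝ)) :=
  contDiff_pi.2 fun j => contDiff_apply ℝ ℝ (⟨j, h j.2⟩ : B)

/-! ### Topology of the latent space and almost sure equality -/

namespace LatentModel

variable {N K : ℕ} {D : Fin K → ℕ} {M : LatentModel N K D}

theorem latentSpace_nonempty (M : LatentModel N K D) : M.latentSpace.Nonempty := by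
  have := M.simplyConnected_latent
  exact nonempty_coe_sort.1 (inferInstance : Nonempty (univ.pi M.factor))

theorem isOpen_factor (M : LatentModel N K D) (j : Fin N) : IsOpen (M.factor j) := by
  have h := isOpenMap_eval j _ M.isOpen_latent
  rwa [eval_image_univ_pi M.latentSpace_nonempty] at h

theorem isOpen_blockSpace (M : LatentModel N K D) (A : Finset (Fin N)) :
    IsOpen (M.blockSpace A) :=
  isOpen_set_pi finite_univ fun j _ => M.isOpen_factor j

theorem restrict_mem_blockSpace {z : Fin N → ℝ} (hz : z ∈ M.latentSpace) (A : Finset (Fin N)) :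
    A.restrict z ∈ M.blockSpace A :=
  fun j _ => hz j (mem_univ _)

theorem extendBlock_mem_latentSpace {A : Finset (Fin N)} {z : Fin N → ℝ} (hz : z ∈ M.latentSpace)
    {w : A → ℝ} (hw : w ∈ M.blockSpace A) : extendBlock A z w ∈ M.latentSpace := by
  intro j _
  by_cases h : j ∈ A
  · simpa [extendBlock, h] using hw ⟨j, h⟩ (mem_univ _)
  · simpa [extendBlock, h] using hz j (mem_univ _)

theorem blockSpace_nonempty (M : LatentModel N K D) (A : Finset (Fin N)) :
    (M.blockSpace A).Nonempty :=
  let ⟨z, hz⟩ := M.latentSpace_nonempty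
  ⟨A.restrict z, restrict_mem_blockSpace hz A⟩

theorem image_view (M : LatentModel N K D) (k : Fin K) : M.view k '' M.latentSpace = M.X k := by
  rw [← (M.mixing_diffeo k).1.image_eq]
  obtain ⟨z, hz⟩ := M.latentSpace_nonempty
  refine Subset.antisymm ?_ ?_
  · rintro _ ⟨w, hw, rfl⟩
    exact ⟨_, restrict_mem_blockSpace hw _, rfl⟩
  · rintro _ ⟨w, hw, rfl⟩
    exact ⟨extendBlock _ z w, extendBlock_mem_latentSpace hz hw, by
      rw [view, restrict_extendBlock]⟩

theorem view_mem {z : Fin N → ℝ} (hz : z ∈ M.latentSpace) (k : Fin K) : M.view k z ∈ M.X k :=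
  M.image_view k ▸ mem_image_of_mem _ hz

theorem contDiffOn_view (M : LatentModel N K D) (k : Fin K) :
    ContDiffOn ℝ ∞ (M.view k) M.latentSpace :=
  (M.mixing_diffeo k).2.1.comp (contDiff_restrict _).contDiffOn
    fun _ hz => restrict_mem_blockSpace hz _

/-- An almost sure property of the latent vector holds almost everywhere on the latent space. -/
theorem ae_restrict_of_ae_latentLaw {p : (Fin N → ℝ) → Prop} (h : ∀ᵐ z ∂M.latentLaw, p z) :
    ∀ᵐ z ∂(volume.restrict M.latentSpace), p z := by
  have hm : AEMeasurable (fun z => ENNReal.ofReal (M.density z))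
      (volume.restrict M.latentSpace) :=
    (M.density_smooth.continuousOn.aemeasurable M.isOpen_latent.measurableSet).ennreal_ofReal
  rw [latentLaw, ae_withDensity_iff' hm] at h
  filter_upwards [h, M.density_pos] with z hz hpos
  exact hz (by simpa using hpos)

/-- Continuous functions that agree almost surely agree on the whole latent space. -/
theorem eqOn_of_ae_latentLaw {Y : Type*} [TopologicalSpace Y] [T2Space Y] {u v : (Fin N → ℝ) → Y}
    (hu : ContinuousOn u M.latentSpace) (hv : ContinuousOn v M.latentSpace)
    (h : ∀ᵐ z ∂M.latentLaw, u z = v z) : EqOn u v M.latentSpace :=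
  Measure.eqOn_open_of_ae_eq (ae_restrict_of_ae_latentLaw h) M.isOpen_latent hu hv

theorem aemeasurable_latentLaw {Y : Type*} [TopologicalSpace Y] [MeasurableSpace Y] [BorelSpace Y]
    {u : (Fin N → ℝ) → Y} (hu : ContinuousOn u M.latentSpace) : AEMeasurable u M.latentLaw :=
  (hu.aemeasurable M.isOpen_latent.measurableSet).mono_ac (withDensity_absolutelyContinuous _ _)

theorem ae_mem_latentSpace (M : LatentModel N K D) : ∀ᵐ z ∂M.latentLaw, z ∈ M.latentSpace :=
  (withDensity_absolutelyContinuous _ _).ae_le (ae_restrict_mem M.isOpen_latent.measurableSet)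

/-! ### Representations that block-identify a set of latents -/

namespace BlockIdentifies

variable {k : Fin K} {A : Finset (Fin N)} {m : ℕ} {g : (Fin (D k) → ℝ) → (Fin m → ℝ)}

theorem contDiffOn_repr (h : M.BlockIdentifies k A g) :
    ContDiffOn ℝ ∞ (fun z => g (M.view k z)) M.latentSpace :=
  h.2.1.comp (M.contDiffOn_view k) fun _ hz => view_mem hz k

theorem repr_eq (h : M.BlockIdentifies k A g) {z w : Fin N → ℝ} (hz : z ∈ M.latentSpace)
    (hw : w ∈ M.latentSpace) (hzw : ∀ j ∈ A, z j = w j) : g (M.view k z) = g (M.view k w) := by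
  obtain ⟨-, -, φ, -, hφ⟩ := h
  rw [hφ z hz, hφ w hw]
  congr 1
  ext j
  exact hzw j j.2

theorem exists_isDiffeoOn (h : M.BlockIdentifies k A g) :
    ∃ φ : (A → ℝ) → (Fin m → ℝ), IsDiffeoOn φ (M.blockSpace A) (g '' M.X k) ∧
      ∀ z ∈ M.latentSpace, g (M.view k z) = φ (A.restrict z) := by
  obtain ⟨-, -, φ, hd, hφ⟩ := h
  obtain ⟨z, hz⟩ := M.latentSpace_nonempty
  refine ⟨φ, ?_, hφ⟩
  have himg : g '' M.X k = φ '' M.blockSpace A := by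
    rw [← M.image_view k]
    refine Subset.antisymm ?_ ?_
    · rintro _ ⟨_, ⟨w, hw, rfl⟩, rfl⟩
      exact ⟨_, restrict_mem_blockSpace hw A, (hφ w hw).symm⟩
    · rintro _ ⟨w, hw, rfl⟩
      have hmem := extendBlock_mem_latentSpace hz hw
      exact ⟨_, ⟨_, hmem, rfl⟩, by rw [hφ _ hmem, restrict_extendBlock]⟩
  rwa [himg]

/-- By Lusin–Souslin, an injective continuous image of a Borel set is Borel. -/
theorem measurableSet_image (h : M.BlockIdentifies k A g) : MeasurableSet (g '' M.X k) := by
  obtain ⟨φ, ⟨hbij, hc, -⟩, -⟩ := h.exists_isDiffeoOn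
  rw [← hbij.image_eq]
  exact (M.isOpen_blockSpace A).measurableSet.image_of_continuousOn_injOn hc.continuousOn hbij.injOn

/-- The block-identified latents can be recovered smoothly from the representation. -/
theorem exists_decoder (h : M.BlockIdentifies k A g) :
    ∃ q : (Fin m → ℝ) → (A → ℝ), ContDiffOn ℝ ∞ q (g '' M.X k) ∧
      ∀ z ∈ M.latentSpace, q (g (M.view k z)) = A.restrict z := by
  obtain ⟨φ, ⟨-, -, q, hinv, hq⟩, hφ⟩ := h.exists_isDiffeoOn
  exact ⟨q, hq, fun z hz => by rw [hφ z hz, hinv (restrict_mem_blockSpace hz A)]⟩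

end BlockIdentifies

/-! ### Comparison of two models with the same representations -/

variable {N' K' : ℕ} {D' : Fin K' → ℕ} {M' : LatentModel N' K' D'}
  {k₁ k₂ : Fin K} {k₁' k₂' : Fin K'} {C₁ C₂ : Finset (Fin N)} {C₁' C₂' : Finset (Fin N')}
  {m₁ m₂ : ℕ} {g₁ : (Fin (D k₁) → ℝ) → (Fin m₁ → ℝ)} {g₂ : (Fin (D k₂) → ℝ) → (Fin m₂ → ℝ)}
  {g₁' : (Fin (D' k₁') → ℝ) → (Fin m₁ → ℝ)} {g₂' : (Fin (D' k₂') → ℝ) → (Fin m₂ → ℝ)}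

/-- Continuous functions of the two representations that agree in one model agree in every model
with the same ranges and the same joint distribution of the representations. -/
theorem eq_of_reprLaw_eq {Y : Type*} [TopologicalSpace Y] [T2Space Y]
    (h₁ : M.BlockIdentifies k₁ C₁ g₁) (h₂ : M.BlockIdentifies k₂ C₂ g₂)
    (h₁' : M'.BlockIdentifies k₁' C₁' g₁') (h₂' : M'.BlockIdentifies k₂' C₂' g₂')
    (hr₁ : g₁' '' M'.X k₁' = g₁ '' M.X k₁) (hr₂ : g₂' '' M'.X k₂' = g₂ '' M.X k₂)
    (hlaw : M'.reprLaw k₁' k₂' g₁' g₂' = M.reprLaw k₁ k₂ g₁ g₂)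
    {γ₁ : (Fin m₁ → ℝ) → Y} {γ₂ : (Fin m₂ → ℝ) → Y}
    (hγ₁ : ContinuousOn γ₁ (g₁ '' M.X k₁)) (hγ₂ : ContinuousOn γ₂ (g₂ '' M.X k₂))
    (heq : ∀ z ∈ M.latentSpace, γ₁ (g₁ (M.view k₁ z)) = γ₂ (g₂ (M.view k₂ z)))
    {z : Fin N' → ℝ} (hz : z ∈ M'.latentSpace) :
    γ₁ (g₁' (M'.view k₁' z)) = γ₂ (g₂' (M'.view k₂' z)) := by
  have hmem₁ : ∀ z ∈ M'.latentSpace, g₁' (M'.view k₁' z) ∈ g₁ '' M.X k₁ := fun z hz =>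
    hr₁ ▸ mem_image_of_mem _ (view_mem hz _)
  have hmem₂ : ∀ z ∈ M'.latentSpace, g₂' (M'.view k₂' z) ∈ g₂ '' M.X k₂ := fun z hz =>
    hr₂ ▸ mem_image_of_mem _ (view_mem hz _)
  set R : Set ((Fin m₁ → ℝ) × (Fin m₂ → ℝ)) := (g₁ '' M.X k₁) ×ˢ (g₂ '' M.X k₂)
  have hR : MeasurableSet R := h₁.measurableSet_image.prod h₂.measurableSet_image
  have hcont : ContinuousOn (fun p : (Fin m₁ → ℝ) × (Fin m₂ → ℝ) => (γ₁ p.1, γ₂ p.2)) R :=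
    (hγ₁.comp continuousOn_fst fun p hp => hp.1).prodMk
      (hγ₂.comp continuousOn_snd fun p hp => hp.2)
  -- Disagreement of `γ₁` and `γ₂` is relatively open in `R`, since the diagonal of `Y` is closed;
  -- this makes the event below Borel.
  obtain ⟨U, hU, hUR⟩ := continuousOn_iff'.1 hcont _ (isClosed_diagonal (X := Y)).isOpen_compl
  have hmeas : MeasurableSet {p : (Fin m₁ → ℝ) × (Fin m₂ → ℝ) | p ∈ R → γ₁ p.1 = γ₂ p.2} := by
    convert (hU.measurableSet.inter hR).compl using 1
    rw [← hUR]
    ext p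
    simp only [mem_ofPred_eq, mem_compl_iff, mem_inter_iff, mem_preimage, mem_diagonal_iff]
    tauto
  have hae : ∀ᵐ p ∂M.reprLaw k₁ k₂ g₁ g₂, p ∈ R → γ₁ p.1 = γ₂ p.2 := by
    rw [reprLaw, ae_map_iff (aemeasurable_latentLaw (h₁.contDiffOn_repr.continuousOn.prodMk
      h₂.contDiffOn_repr.continuousOn)) hmeas]
    filter_upwards [M.ae_mem_latentSpace] with w hw _ using heq w hw
  rw [← hlaw, reprLaw] at hae
  have hae' := ae_of_ae_map (aemeasurable_latentLaw (h₁'.contDiffOn_repr.continuousOn.prodMk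
    h₂'.contDiffOn_repr.continuousOn)) hae
  refine eqOn_of_ae_latentLaw (hγ₁.comp h₁'.contDiffOn_repr.continuousOn hmem₁)
    (hγ₂.comp h₂'.contDiffOn_repr.continuousOn hmem₂) ?_ hz
  filter_upwards [hae', M'.ae_mem_latentSpace] with w hw hwmem
  exact hw ⟨hmem₁ w hwmem, hmem₂ w hwmem⟩

/-- A function of `z_{C₁}` which is also a function of `z_{C₂}` is a function of `z_{C₁ ∩ C₂}`. -/
theorem eq_of_eqOn_inter {Y : Type*} {γ₁ : (Fin m₁ → ℝ) → Y} {γ₂ : (Fin m₂ → ℝ) → Y}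
    (h₁ : M.BlockIdentifies k₁ C₁ g₁) (h₂ : M.BlockIdentifies k₂ C₂ g₂)
    (heq : ∀ z ∈ M.latentSpace, γ₁ (g₁ (M.view k₁ z)) = γ₂ (g₂ (M.view k₂ z)))
    {z w : Fin N → ℝ} (hz : z ∈ M.latentSpace) (hw : w ∈ M.latentSpace)
    (hzw : (C₁ ∩ C₂).restrict z = (C₁ ∩ C₂).restrict w) :
    γ₁ (g₁ (M.view k₁ z)) = γ₁ (g₁ (M.view k₁ w)) := by
  -- The hybrid point takes its `C₁` coordinates from `z` and the others from `w`. It agrees with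
  -- `z` on `C₁` and with `w` on `C₂`, so `γ₁` can be traded for `γ₂` there.
  have hu := extendBlock_mem_latentSpace hw (restrict_mem_blockSpace hz C₁)
  rw [h₁.repr_eq hz hu fun j hj => by simp [extendBlock, hj], heq _ hu, heq w hw]
  congr 1
  refine h₂.repr_eq hu hw fun j hj => ?_
  by_cases h : j ∈ C₁
  · simpa [extendBlock, h] using congrFun hzw ⟨j, Finset.mem_inter.2 ⟨h, hj⟩⟩
  · simp [extendBlock, h]

/-- Decoding the shared block of one model from the representations of another model is a
diffeomorphism between the shared blocks. -/
theorem exists_isDiffeoOn_inter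
    (h₁ : M.BlockIdentifies k₁ C₁ g₁) (h₂ : M.BlockIdentifies k₂ C₂ g₂)
    (h₁' : M'.BlockIdentifies k₁' C₁' g₁') (h₂' : M'.BlockIdentifies k₂' C₂' g₂')
    (hr₁ : g₁' '' M'.X k₁' = g₁ '' M.X k₁) (hr₂ : g₂' '' M'.X k₂' = g₂ '' M.X k₂)
    (hlaw : M'.reprLaw k₁' k₂' g₁' g₂' = M.reprLaw k₁ k₂ g₁ g₂)
    {q₁ : (Fin m₁ → ℝ) → (C₁ → ℝ)} {q₂ : (Fin m₂ → ℝ) → (C₂ → ℝ)}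
    (hq₁ : ContDiffOn ℝ ∞ q₁ (g₁ '' M.X k₁)) (hq₂ : ContDiffOn ℝ ∞ q₂ (g₂ '' M.X k₂))
    (hinv₁ : ∀ z ∈ M.latentSpace, q₁ (g₁ (M.view k₁ z)) = C₁.restrict z)
    (hinv₂ : ∀ z ∈ M.latentSpace, q₂ (g₂ (M.view k₂ z)) = C₂.restrict z) :
    ∃ ψ : ((C₁' ∩ C₂' : Finset (Fin N')) → ℝ) → ((C₁ ∩ C₂ : Finset (Fin N)) → ℝ),
      IsDiffeoOn ψ (M'.blockSpace (C₁' ∩ C₂')) (ψ '' M'.blockSpace (C₁' ∩ C₂')) ∧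
      (∀ z ∈ M'.latentSpace, Finset.restrict₂ (π := fun _ => ℝ) Finset.inter_subset_left
        (q₁ (g₁' (M'.view k₁' z))) = ψ ((C₁' ∩ C₂').restrict z)) ∧
      ∀ z ∈ M'.latentSpace, Finset.restrict₂ (π := fun _ => ℝ) Finset.inter_subset_right
        (q₂ (g₂' (M'.view k₂' z))) = ψ ((C₁' ∩ C₂').restrict z) := by
  obtain ⟨q₁', hq₁', hinv₁'⟩ := h₁'.exists_decoder
  obtain ⟨q₂', hq₂', hinv₂'⟩ := h₂'.exists_decoder
  obtain ⟨z₀, hz₀⟩ := M.latentSpace_nonempty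
  obtain ⟨z₀', hz₀'⟩ := M'.latentSpace_nonempty
  set γ₁ : (Fin m₁ → ℝ) → ((C₁ ∩ C₂ : Finset (Fin N)) → ℝ) := fun y =>
    Finset.restrict₂ (π := fun _ => ℝ) Finset.inter_subset_left (q₁ y)
  set γ₂ : (Fin m₂ → ℝ) → ((C₁ ∩ C₂ : Finset (Fin N)) → ℝ) := fun y =>
    Finset.restrict₂ (π := fun _ => ℝ) Finset.inter_subset_right (q₂ y)
  set γ₁' : (Fin m₁ → ℝ) → ((C₁' ∩ C₂' : Finset (Fin N')) → ℝ) := fun y =>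
    Finset.restrict₂ (π := fun _ => ℝ) Finset.inter_subset_left (q₁' y)
  set γ₂' : (Fin m₂ → ℝ) → ((C₁' ∩ C₂' : Finset (Fin N')) → ℝ) := fun y =>
    Finset.restrict₂ (π := fun _ => ℝ) Finset.inter_subset_right (q₂' y)
  have hγ₁ : ContDiffOn ℝ ∞ γ₁ (g₁ '' M.X k₁) := (contDiff_restrict₂ _).comp_contDiffOn hq₁
  have hγ₂ : ContDiffOn ℝ ∞ γ₂ (g₂ '' M.X k₂) := (contDiff_restrict₂ _).comp_contDiffOn hq₂
  have hγ₁' : ContDiffOn ℝ ∞ γ₁' (g₁' '' M'.X k₁') := (contDiff_restrict₂ _).comp_contDiffOn hq₁'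
  have hγ₂' : ContDiffOn ℝ ∞ γ₂' (g₂' '' M'.X k₂') := (contDiff_restrict₂ _).comp_contDiffOn hq₂'
  have hdec : ∀ z ∈ M.latentSpace, γ₁ (g₁ (M.view k₁ z)) = (C₁ ∩ C₂).restrict z := fun z hz => by
    simp only [γ₁, hinv₁ z hz]; rfl
  have hdec' : ∀ z ∈ M'.latentSpace, γ₁' (g₁' (M'.view k₁' z)) = (C₁' ∩ C₂').restrict z :=
    fun z hz => by simp only [γ₁', hinv₁' z hz]; rfl
  have hagree : ∀ z ∈ M'.latentSpace, γ₁ (g₁' (M'.view k₁' z)) = γ₂ (g₂' (M'.view k₂' z)) :=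
    fun z hz => eq_of_reprLaw_eq h₁ h₂ h₁' h₂' hr₁ hr₂ hlaw hγ₁.continuousOn hγ₂.continuousOn
      (fun w hw => by rw [hdec w hw]; simp only [γ₂, hinv₂ w hw]; rfl) hz
  have hagree' : ∀ z ∈ M.latentSpace, γ₁' (g₁ (M.view k₁ z)) = γ₂' (g₂ (M.view k₂ z)) :=
    fun z hz => eq_of_reprLaw_eq h₁' h₂' h₁ h₂ hr₁.symm hr₂.symm hlaw.symm hγ₁'.continuousOn
      hγ₂'.continuousOn (fun w hw => by rw [hdec' w hw]; simp only [γ₂', hinv₂' w hw]; rfl) hz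
  -- Only the first representation is matched; this suffices because `γ₁` and `γ₁'` read nothing
  -- else.
  have hmatch : ∀ z ∈ M'.latentSpace, ∃ w ∈ M.latentSpace,
      g₁ (M.view k₁ w) = g₁' (M'.view k₁' z) := fun z hz => by
    have hmem : g₁' (M'.view k₁' z) ∈ g₁ '' M.X k₁ := hr₁ ▸ mem_image_of_mem _ (view_mem hz _)
    rw [← M.image_view k₁, image_image] at hmem
    exact hmem
  have hext : ∀ v ∈ M'.blockSpace (C₁' ∩ C₂'), extendBlock _ z₀' v ∈ M'.latentSpace :=
    fun v hv => extendBlock_mem_latentSpace hz₀' hv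
  have hψ : ∀ z ∈ M'.latentSpace, γ₁ (g₁' (M'.view k₁' z)) =
      γ₁ (g₁' (M'.view k₁' (extendBlock _ z₀' ((C₁' ∩ C₂').restrict z)))) := fun z hz =>
    eq_of_eqOn_inter h₁' h₂' hagree hz (hext _ (restrict_mem_blockSpace hz _))
      (restrict_extendBlock _ _ _).symm
  -- The candidate inverse is `ψ` with the models exchanged. Its base point `z₀` is harmless: by
  -- `hagree'` only the shared block of `M` matters.
  have hinv : LeftInvOn (fun u => γ₁' (g₁ (M.view k₁ (extendBlock (C₁ ∩ C₂) z₀ u))))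
      (fun v => γ₁ (g₁' (M'.view k₁' (extendBlock (C₁' ∩ C₂') z₀' v))))
      (M'.blockSpace (C₁' ∩ C₂')) := fun v hv => by
    obtain ⟨w, hw, hweq⟩ := hmatch _ (hext v hv)
    have hmem : γ₁ (g₁' (M'.view k₁' (extendBlock (C₁' ∩ C₂') z₀' v))) ∈
        M.blockSpace (C₁ ∩ C₂) := by
      rw [← hweq, hdec w hw]
      exact restrict_mem_blockSpace hw _
    refine (eq_of_eqOn_inter h₁ h₂ hagree' (extendBlock_mem_latentSpace hz₀ hmem) hw ?_).trans ?_
    · rw [restrict_extendBlock, ← hweq, hdec w hw]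
    · rw [hweq, hdec' _ (hext v hv), restrict_extendBlock]
  have hmaps : (fun v => γ₁ (g₁' (M'.view k₁' (extendBlock (C₁' ∩ C₂') z₀' v)))) ''
      M'.blockSpace (C₁' ∩ C₂') ⊆ M.blockSpace (C₁ ∩ C₂) := by
    rintro _ ⟨v, hv, rfl⟩
    obtain ⟨w, hw, hweq⟩ := hmatch _ (hext v hv)
    simp only [← hweq, hdec w hw]
    exact restrict_mem_blockSpace hw _
  refine ⟨_, ⟨hinv.injOn.bijOn_image, ?_, _, hinv, ?_⟩, hψ, fun z hz =>
    (hagree z hz).symm.trans (hψ z hz)⟩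
  · exact hγ₁.comp (h₁'.contDiffOn_repr.comp (contDiff_extendBlock _ _).contDiffOn hext)
      fun v hv => hr₁ ▸ mem_image_of_mem _ (view_mem (hext v hv) _)
  · refine ContDiffOn.mono ?_ hmaps
    exact hγ₁'.comp (h₁.contDiffOn_repr.comp (contDiff_extendBlock _ _).contDiffOn
      fun u hu => extendBlock_mem_latentSpace hz₀ hu) fun u hu => hr₁ ▸
        mem_image_of_mem _ (view_mem (extendBlock_mem_latentSpace hz₀ hu) _)

/-- `ψ` is a diffeomorphism from a nonempty open set, so it cannot lower the dimension. -/
theorem card_inter_le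
    (h₁ : M.BlockIdentifies k₁ C₁ g₁) (h₂ : M.BlockIdentifies k₂ C₂ g₂)
    (h₁' : M'.BlockIdentifies k₁' C₁' g₁') (h₂' : M'.BlockIdentifies k₂' C₂' g₂')
    (hr₁ : g₁' '' M'.X k₁' = g₁ '' M.X k₁) (hr₂ : g₂' '' M'.X k₂' = g₂ '' M.X k₂)
    (hlaw : M'.reprLaw k₁' k₂' g₁' g₂' = M.reprLaw k₁ k₂ g₁ g₂) :
    (C₁' ∩ C₂').card ≤ (C₁ ∩ C₂).card := by
  obtain ⟨q₁, hq₁, hinv₁⟩ := h₁.exists_decoder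
  obtain ⟨q₂, hq₂, hinv₂⟩ := h₂.exists_decoder
  obtain ⟨ψ, hψ, -⟩ :=
    exists_isDiffeoOn_inter h₁ h₂ h₁' h₂' hr₁ hr₂ hlaw hq₁ hq₂ hinv₁ hinv₂
  simpa only [Module.finrank_fintype_fun_eq_card, Fintype.card_coe] using
    hψ.finrank_le (M'.isOpen_blockSpace _) (M'.blockSpace_nonempty _)

end LatentModel

/-! ### Relabelling of coordinates and the main theorem -/

theorem IsDiffeoOn.continuousLinearEquiv_comp {E F G : Type*} [NormedAddCommGroup E]
    [NormedSpace ℝ E] [NormedAddCommGroup F] [NormedSpace ℝ F] [NormedAddCommGroup G]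
    [NormedSpace ℝ G] {f : E → F} {s : Set E} {t : Set F} (hf : IsDiffeoOn f s t)
    (e : F ≃L[ℝ] G) : IsDiffeoOn (e ∘ f) s (e '' t) := by
  obtain ⟨hbij, hsmooth, f', hinv, hsmooth'⟩ := hf
  refine ⟨e.injective.injOn.bijOn_image.comp hbij, e.contDiff.comp_contDiffOn hsmooth,
    f' ∘ e.symm, fun x hx => ?_, hsmooth'.comp e.symm.contDiff.contDiffOn ?_⟩
  · simpa using hinv hx
  · rintro _ ⟨y, hy, rfl⟩
    simpa using hy

theorem mainTheorem3 {N K : ℕ} {D : Fin K → ℕ} (M : LatentModel N K D)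
    (k₁ k₂ : Fin K) (C₁ C₂ : Finset (Fin N)) {m₁ m₂ : ℕ}
    (g₁ : (Fin (D k₁) → ℝ) → (Fin m₁ → ℝ)) (g₂ : (Fin (D k₂) → ℝ) → (Fin m₂ → ℝ))
    (h₁ : M.BlockIdentifies k₁ C₁ g₁) (h₂ : M.BlockIdentifies k₂ C₂ g₂) :
    ∃ (γ₁ : (Fin m₁ → ℝ) → (Fin (C₁ ∩ C₂).card → ℝ))
      (γ₂ : (Fin m₂ → ℝ) → (Fin (C₁ ∩ C₂).card → ℝ)),
      ContDiffOn ℝ ∞ γ₁ (g₁ '' M.X k₁) ∧ ContDiffOn ℝ ∞ γ₂ (g₂ '' M.X k₂) ∧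
      M.BlockIdentifies k₁ (C₁ ∩ C₂) (γ₁ ∘ g₁) ∧
      M.BlockIdentifies k₂ (C₁ ∩ C₂) (γ₂ ∘ g₂) ∧
      -- the same `γ₁`, `γ₂` work in every model that explains the same representations,
      -- so that they are determined by the observable data alone
      ∀ (N' K' : ℕ) (D' : Fin K' → ℕ) (M' : LatentModel N' K' D')
        (k₁' k₂' : Fin K') (C₁' C₂' : Finset (Fin N'))
        (g₁' : (Fin (D' k₁') → ℝ) → (Fin m₁ → ℝ)) (g₂' : (Fin (D' k₂') → ℝ) → (Fin m₂ → ℝ)),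
        M'.BlockIdentifies k₁' C₁' g₁' → M'.BlockIdentifies k₂' C₂' g₂' →
        g₁' '' M'.X k₁' = g₁ '' M.X k₁ → g₂' '' M'.X k₂' = g₂ '' M.X k₂ →
        M'.reprLaw k₁' k₂' g₁' g₂' = M.reprLaw k₁ k₂ g₁ g₂ →
        M'.BlockIdentifies k₁' (C₁' ∩ C₂') (γ₁ ∘ g₁') ∧
        M'.BlockIdentifies k₂' (C₁' ∩ C₂') (γ₂ ∘ g₂') := by
  obtain ⟨q₁, hq₁, hinv₁⟩ := h₁.exists_decoder
  obtain ⟨q₂, hq₂, hinv₂⟩ := h₂.exists_decoder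
  set e : ((C₁ ∩ C₂ : Finset (Fin N)) → ℝ) ≃L[ℝ] (Fin (C₁ ∩ C₂).card → ℝ) :=
    (LinearEquiv.funCongrLeft ℝ ℝ (C₁ ∩ C₂).equivFin.symm).toContinuousLinearEquiv
  set γ₁ : (Fin m₁ → ℝ) → (Fin (C₁ ∩ C₂).card → ℝ) := fun y =>
    e (Finset.restrict₂ (π := fun _ => ℝ) Finset.inter_subset_left (q₁ y))
  set γ₂ : (Fin m₂ → ℝ) → (Fin (C₁ ∩ C₂).card → ℝ) := fun y =>
    e (Finset.restrict₂ (π := fun _ => ℝ) Finset.inter_subset_right (q₂ y))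
  have hγ₁ : ContDiffOn ℝ ∞ γ₁ (g₁ '' M.X k₁) :=
    (e.contDiff.comp (contDiff_restrict₂ _)).comp_contDiffOn hq₁
  have hγ₂ : ContDiffOn ℝ ∞ γ₂ (g₂ '' M.X k₂) :=
    (e.contDiff.comp (contDiff_restrict₂ _)).comp_contDiffOn hq₂
  have key : ∀ (N' K' : ℕ) (D' : Fin K' → ℕ) (M' : LatentModel N' K' D')
      (k₁' k₂' : Fin K') (C₁' C₂' : Finset (Fin N'))
      (g₁' : (Fin (D' k₁') → ℝ) → (Fin m₁ → ℝ)) (g₂' : (Fin (D' k₂') → ℝ) → (Fin m₂ → ℝ)),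
      M'.BlockIdentifies k₁' C₁' g₁' → M'.BlockIdentifies k₂' C₂' g₂' →
      g₁' '' M'.X k₁' = g₁ '' M.X k₁ → g₂' '' M'.X k₂' = g₂ '' M.X k₂ →
      M'.reprLaw k₁' k₂' g₁' g₂' = M.reprLaw k₁ k₂ g₁ g₂ →
      M'.BlockIdentifies k₁' (C₁' ∩ C₂') (γ₁ ∘ g₁') ∧
      M'.BlockIdentifies k₂' (C₁' ∩ C₂') (γ₂ ∘ g₂') := by
    intro N' K' D' M' k₁' k₂' C₁' C₂' g₁' g₂' h₁' h₂' hr₁ hr₂ hlaw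
    -- The output dimension of `γ₁` and `γ₂` is fixed by `M`, so it must be shown to fit `M'` as
    -- well.
    have hcard : (C₁ ∩ C₂).card = (C₁' ∩ C₂').card := le_antisymm
      (LatentModel.card_inter_le h₁' h₂' h₁ h₂ hr₁.symm hr₂.symm hlaw.symm)
      (LatentModel.card_inter_le h₁ h₂ h₁' h₂' hr₁ hr₂ hlaw)
    obtain ⟨ψ, hψ, hψ₁, hψ₂⟩ := LatentModel.exists_isDiffeoOn_inter h₁ h₂ h₁' h₂' hr₁ hr₂ hlaw
      hq₁ hq₂ hinv₁ hinv₂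
    have hd := hψ.continuousLinearEquiv_comp e
    rw [← image_comp] at hd
    exact ⟨⟨hcard, hγ₁.comp h₁'.2.1 fun x hx => hr₁ ▸ mem_image_of_mem _ hx, e ∘ ψ, hd,
        fun z hz => congrArg e (hψ₁ z hz)⟩,
      ⟨hcard, hγ₂.comp h₂'.2.1 fun x hx => hr₂ ▸ mem_image_of_mem _ hx, e ∘ ψ, hd,
        fun z hz => congrArg e (hψ₂ z hz)⟩⟩
  -- `M` explains its own representations, so it is a special case.
  obtain ⟨hM₁, hM₂⟩ := key N K D M k₁ k₂ C₁ C₂ g₁ g₂ h₁ h₂ rfl rfl rfl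
  exact ⟨γ₁, γ₂, hγ₁, hγ₂, hM₁, hM₂, key⟩
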